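/- Let $1\le p<\infty$ and let $E,F$ be (real or complex) Banach spaces with closed unit balls $B_E, B_F$ and duals $E',F'$. For $x=(x_n)_n\in\ell_p(F)$ let $\|x\|_p=(\sum_n\|x_n\|^p)^{1/p}$ and $p\text{-co}\{x_n\}=\{\sum_n\alpha_nx_n:(\alpha_n)_n\in B_{\ell_{p'}}\}$, where $\frac1p+\frac1{p'}=1$ and $\ell_{p'}$ is replaced by $c_0$ if $p=1$. An operator $T\in\mathcal L(E;F)$ is $p$-compact, $T\in\mathcal K_p(E;F)$, if $T(B_E)\subset p\text{-co}\{x_n\}$ for some $(x_n)_n\in\ell_p(F)$; its norm $\kappa_p(T)$ is the infimum of $\|(x_n)_n\|_p$ over all such sequences. The maximal hull $\mathcal K_p^{max}(E;F)$ consists of all $T\in\mathcal L(E;F)$ with $$\kappa_p^{max}(T)=\sup_{M,L}\kappa_p\big(Q_L\,T\,I_M\big)<\infty ,$$ where $M$ ranges over the finite-dimensional subspaces of $E$, $L$ over the closed finite-codimensional subspaces of $F$, $I_M:M\to E$ is the inclusion and $Q_L:F\to F/L$ the quotient map. An operator $S$ between Banach spaces $X$ and $Y$ is $p$-summing, $S\in\Pi_p(X;Y)$,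 if there is $C\ge0$ such that $$\Big(\sum_{i=1}^n\|Sx_i\|^p\Big)^{1/p}\le C\sup_{x'\in B_{X'}}\Big(\sum_{i=1}^n|x'(x_i)|^p\Big)^{1/p}$$ for all finite families $x_1,\dots,x_n\in X$; $\pi_p(S)$ is the infimum of such $C$. The dual ideal $\Pi_p^{dual}(E;F)$ consists of all $T\in\mathcal L(E;F)$ whose adjoint $T':F'\to E'$ is $p$-summing, with norm $\pi_p^{dual}(T)=\pi_p(T')$. Then $\mathcal K_p^{max}$ and $\Pi_p^{dual}$ coincide isometrically: for all Banach spaces $E,F$ one has $\mathcal K_p^{max}(E;F)=\Pi_p^{dual}(E;F)$, and $\kappa_p^{max}(T)=\pi_p(T')$ for every $T$ in this space. -/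

import Mathlib

open scoped ENNReal NNReal Topology

noncomputable section

namespace PCompact

universe u v w

/-- A rule assigning to each bounded operator between normed spaces over `𝕜` a value in `[0, ∞]`.
A normed operator ideal `(𝒜, ‖·‖_𝒜)` is encoded by the rule that sends `T` to `‖T‖_𝒜` if `T ∈ 𝒜`
and to `∞` otherwise (only its values on operators between Banach spaces matter). -/
abbrev OperatorGauge (𝕜 : Type w) [RCLike 𝕜] : Type (max (u + 1) (v + 1) w) :=
  ∀ (E : Type u) (F : Type v) [NormedAddCommGroup E] [NormedSpace 𝕜 E]
    [NormedAddCommGroup F] [NormedSpace 𝕜 F], (E →L[𝕜] F) → ℝ≥0∞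

/-- The component `𝒜(E; F)` of the class of operators on which the gauge is finite. -/
def component {𝕜 : Type w} [RCLike 𝕜] (A : OperatorGauge.{u, v, w} 𝕜)
    (E : Type u) (F : Type v) [NormedAddCommGroup E] [NormedSpace 𝕜 E]
    [NormedAddCommGroup F] [NormedSpace 𝕜 F] : Set (E →L[𝕜] F) :=
  {T | A E F T < ∞}

/-- The norm `(∑ ‖x_n‖ ^ p) ^ (1 / p)` of a sequence; it is finite exactly when `x ∈ ℓ_p(F)`. -/
def strongNorm {F : Type v} [NormedAddCommGroup F] (p : ℝ) (x : ℕ → F) : ℝ≥0∞ :=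
  (∑' n, ‖x n‖ₑ ^ p) ^ (1 / p)

/-- The closed unit ball of `ℓ_{p'}`, `1 / p + 1 / p' = 1`, where `ℓ_{p'}` means `c₀` if `p = 1`. -/
def coeffBall (𝕜 : Type w) [RCLike 𝕜] (p : ℝ) : Set (ℕ → 𝕜) :=
  {a | if p = 1 then Filter.Tendsto a Filter.atTop (𝓝 0) ∧ ∀ n, ‖a n‖ ≤ 1
    else strongNorm p.conjExponent a ≤ 1}

/-- The `p`-convex hull `{∑ aₙ xₙ : (aₙ) in the unit ball of ℓ_{p'}}` of a sequence. -/
def pConvexHull (𝕜 : Type w) [RCLike 𝕜] {F : Type v} [NormedAddCommGroup F] [NormedSpace 𝕜 F]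
    (p : ℝ) (x : ℕ → F) : Set F :=
  {y | ∃ a ∈ coeffBall 𝕜 p, HasSum (fun n => a n • x n) y}

/-- The size `m_p(K; F)` of a set: the infimum of the `ℓ_p(F)`-norms of the sequences in `ℓ_p(F)`
whose `p`-convex hull contains `K`, and `∞` if there is no such sequence, that is, if `K` is not
relatively `p`-compact. -/
def pSize (𝕜 : Type w) [RCLike 𝕜] {F : Type v} [NormedAddCommGroup F] [NormedSpace 𝕜 F]
    (p : ℝ) (K : Set F) : ℝ≥0∞ :=
  ⨅ (x : ℕ → F) (_ : strongNorm p x < ∞) (_ : K ⊆ pConvexHull 𝕜 p x), strongNorm p x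

/-- The ideal `(𝒦_p, κ_p)` of `p`-compact operators: `κ_p(T) = m_p(T(B_E); F)`, and `T` is
`p`-compact when this is finite. -/
def kappa (𝕜 : Type w) [RCLike 𝕜] (p : ℝ) : OperatorGauge.{u, v, w} 𝕜 :=
  fun E _ _ _ _ _ T => pSize 𝕜 p (T '' Metric.closedBall (0 : E) 1)

/-- The weak `ℓ_p`-norm of a finite family, the supremum over the closed unit ball of the dual. -/
def weakNorm (𝕜 : Type w) [RCLike 𝕜] {E : Type u} [NormedAddCommGroup E] [NormedSpace 𝕜 E]
    (p : ℝ) {n : ℕ} (x : Fin n → E) : ℝ≥0∞ :=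
  ⨆ (f : StrongDual 𝕜 E) (_ : ‖f‖ ≤ 1), (∑ i, ‖f (x i)‖ₑ ^ p) ^ (1 / p)

/-- The ideal `(Π_p, π_p)` of absolutely `p`-summing operators: `π_p(T)` is the infimum of the
constants `C` with `(∑ ‖T xᵢ‖ ^ p) ^ (1 / p) ≤ C * weakNorm p x` for all finite families `x`. -/
def summing (𝕜 : Type w) [RCLike 𝕜] (p : ℝ) : OperatorGauge.{u, v, w} 𝕜 :=
  fun E _ _ _ _ _ T =>
    ⨅ (C : ℝ≥0) (_ : ∀ (n : ℕ) (x : Fin n → E),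
      (∑ i, ‖T (x i)‖ₑ ^ p) ^ (1 / p) ≤ (C : ℝ≥0∞) * weakNorm 𝕜 p x), (C : ℝ≥0∞)

/-- The dual ideal: `T ∈ 𝒜^dual` if and only if its Banach space adjoint `T' : F' → E'`,
`f ↦ f ∘ T`, is in `𝒜`, with the norm of `T'` in `𝒜`. -/
def dualIdeal {𝕜 : Type w} [RCLike 𝕜] (A : OperatorGauge.{max v w, max u w, w} 𝕜) :
    OperatorGauge.{u, v, w} 𝕜 :=
  fun E F _ _ _ _ T =>
    A (StrongDual 𝕜 F) (StrongDual 𝕜 E) (ContinuousLinearMap.precomp 𝕜 T)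

/-- The maximal hull: the norm of `T : E → F` is the supremum of the `𝒜`-norms of
`Q_L ∘ T ∘ I_M : M → F ⧸ L`, with `M` a finite-dimensional subspace of `E` (inclusion `I_M`) and
`L` a closed finite-codimensional subspace of `F` (quotient map `Q_L`). -/
def maximalHull {𝕜 : Type w} [RCLike 𝕜] (A : OperatorGauge.{u, v, w} 𝕜) :
    OperatorGauge.{u, v, w} 𝕜 :=
  fun E F _ _ _ _ T =>
    ⨆ (M : Submodule 𝕜 E) (_ : FiniteDimensional 𝕜 M)
      (L : Submodule 𝕜 F) (_ : IsClosed (L : Set F)) (_ : FiniteDimensional 𝕜 (F ⧸ L)),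
      A M (F ⧸ L) (L.mkQL ∘L T ∘L M.subtypeL)

end PCompact

end

/-!
Fix `T : E → F`. The two inequalities between `κ_p^max(T)` and `π_p(T')` are proved separately.

`κ_p^max(T) ≤ π_p(T')`. Let `C` be a summing constant of `T'`, and let `S : M → G = F ⧸ L` be one of
the finite-dimensional operators `Q_L T I_M`. Since `G` is finite-dimensional, it equals its bidual
(`exists_forall_apply_eq`), and the supremum that defines the weak norm of a family in `G'` may be
taken over a finite net of the unit ball of `G`, at the price of a factor `r > 1`
(`exists_norm_le_norm_apply_of_net`). Separating a convex cone from the open negative orthant of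
`ℝ^N` (`exists_weights`) turns the summing inequality into a Pietsch domination by a measure carried
by the net: there are `z₁, …, z_N ∈ G` with `(∑ ‖z_k‖ ^ p) ^ (1 / p) ≤ r C` and
`‖g ∘ S‖ ^ p ≤ ∑ |g z_k| ^ p` for all `g ∈ G'` (`exists_finite_domination`). For `v = S x` with
`‖x‖ ≤ 1`, the map `(g z_k)_k ↦ g v` is then a functional of norm at most `1` on a subspace of
`ℓ_p^N`; a Hahn–Banach extension of it to `ℓ_p^N` is a vector `a` in the unit ball of `ℓ_{p'}^N`
with `v = ∑ a_k z_k` (`exists_coeff_of_forall_dual`). So `S` maps the unit ball into the `p`-convex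
hull of the `z_k`, and `κ_p(S) ≤ r C` (`kappa_mkQL_comp_le`).

`π_p(T') ≤ κ_p^max(T)`. Given `f₁, …, f_n ∈ F'`, choose `e_i` in the unit ball of `E` that nearly
norm the functionals `f_i ∘ T`, and let `M` be the span of the `e_i` and `L` the intersection of the
kernels of the `f_i`. If `Q_L T I_M` maps the unit ball into the `p`-convex hull of `(x_m)`, then
Hölder's inequality bounds `|f_i (T e_i)| ^ p` by `∑_m |g_i (x_m)| ^ p`, where `f_i = g_i ∘ Q_L`.
Summing over `i` first, and lifting `x_m` to `F` almost without increasing the norm, bounds this by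
the weak norm of the `f_i` times the norm of `(x_m)`
(`sum_enorm_comp_le_of_maximalHull_kappa_lt`).
-/

namespace PCompact

variable {𝕜 : Type*} [RCLike 𝕜]

/-! ### Inequalities up to a factor, and finite `ℓ_p` norms -/

theorem le_of_forall_one_lt_mul_le {a b : ℝ≥0∞} (h : ∀ r : ℝ≥0, 1 < r → a ≤ r * b) : a ≤ b := by
  have hlim : Filter.Tendsto (fun r : ℝ≥0 => (r : ℝ≥0∞) * b) (𝓝[>] 1) (𝓝 (1 * b)) := by
    refine ENNReal.Tendsto.mul_const ?_ (Or.inl one_ne_zero)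
    exact (ENNReal.continuous_coe.tendsto 1).mono_left nhdsWithin_le_nhds
  rw [one_mul] at hlim
  exact ge_of_tendsto hlim (by filter_upwards [self_mem_nhdsWithin] with r hr using h r hr)

theorem ofReal_sum_norm_rpow {H ι : Type*} [SeminormedAddCommGroup H] [Fintype ι] {p : ℝ}
    (hp : 0 < p) (c : ι → H) :
    ENNReal.ofReal ((∑ i, ‖c i‖ ^ p) ^ (1 / p)) = (∑ i, ‖c i‖ₑ ^ p) ^ (1 / p) := by
  rw [← ENNReal.ofReal_rpow_of_nonneg (by positivity) (by positivity),
    ENNReal.ofReal_sum_of_nonneg fun _ _ => by positivity]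
  simp_rw [← ENNReal.ofReal_rpow_of_nonneg (norm_nonneg _) hp.le, ofReal_norm]

theorem sum_mul_rpow {ι : Type*} [Fintype ι] {p : ℝ} (hp : 0 < p) (r : ℝ≥0∞) (c : ι → ℝ≥0∞) :
    (∑ i, (r * c i) ^ p) ^ (1 / p) = r * (∑ i, c i ^ p) ^ (1 / p) := by
  simp_rw [ENNReal.mul_rpow_of_nonneg _ _ hp.le]
  rw [← Finset.mul_sum, ENNReal.mul_rpow_of_nonneg _ _ (by positivity), ← ENNReal.rpow_mul,
    mul_one_div_cancel hp.ne', ENNReal.rpow_one]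

/-! ### A finite Pietsch domination theorem -/

/-- A minimax principle. The hypothesis `hsmul` makes the family of vectors `(b x k - a x)_k` stable
under multiplication by nonnegative scalars, so that its convex hull consists of finite sums of
its members; by `h` such a sum is never negative in every coordinate. The weights are
the coefficients of a functional separating this hull from the open negative orthant. -/
theorem exists_weights {X ι : Type*} [Fintype ι] [Nonempty X] (a : X → ℝ) (b : X → ι → ℝ)
    (hsmul : ∀ t : ℝ, 0 ≤ t → ∀ x, ∃ y, a y = t * a x ∧ ∀ k, b y k = t * b x k)
    (h : ∀ (n : ℕ) (x : Fin n → X), ∃ k, ∑ i, a (x i) ≤ ∑ i, b (x i) k) :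
    ∃ w : ι → ℝ, (∀ k, 0 ≤ w k) ∧ ∑ k, w k = 1 ∧ ∀ x, a x ≤ ∑ k, w k * b x k := by
  classical
  set U : Set (ι → ℝ) := {v | ∀ k, v k < 0} with hU
  set S : Set (ι → ℝ) := Set.range fun x k => b x k - a x with hS
  have hUconv : Convex ℝ U := by
    have : U = Set.univ.pi fun _ => Set.Iio (0 : ℝ) := by ext; simp [hU]
    rw [this]
    exact convex_pi fun _ _ => convex_Iio 0
  have hUopen : IsOpen U := by
    have : U = Set.univ.pi fun _ => Set.Iio (0 : ℝ) := by ext; simp [hU]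
    rw [this]
    exact isOpen_set_pi Set.finite_univ fun _ _ => isOpen_Iio
  have hdisj : Disjoint U (convexHull ℝ S) := by
    rw [Set.disjoint_left]
    intro v hv hv'
    obtain ⟨κ, _, c, z, hc, -, hz, rfl⟩ := mem_convexHull_iff_exists_fintype.1 hv'
    choose x hx using hz
    choose y hya hyb using fun i => hsmul (c i) (hc i) (x i)
    obtain ⟨k, hk⟩ := h _ (y ∘ (Fintype.equivFin κ).symm)
    have e1 := Equiv.sum_comp (Fintype.equivFin κ).symm fun i => a (y i)
    have e2 := Equiv.sum_comp (Fintype.equivFin κ).symm fun i => b (y i) k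
    have hvk := hv k
    simp only [Function.comp_apply] at hk
    rw [e1, e2] at hk
    have : (∑ i, c i • z i) k = ∑ i, b (y i) k - ∑ i, a (y i) := by
      rw [← Finset.sum_sub_distrib, Finset.sum_apply]
      refine Finset.sum_congr rfl fun i _ => ?_
      rw [hya, hyb, ← hx i]
      simp [mul_sub]
    rw [this] at hvk
    linarith
  obtain ⟨f, u, hfU, hfS⟩ :=
    geometric_hahn_banach_open hUconv hUopen (convex_convexHull ℝ S) hdisj
  -- The separating functional is `v ↦ ∑ k, v k * l k`; its coefficients still have to be normalized.
  set l : ι → ℝ := fun k => f (Pi.single k 1) with hl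
  have hf : ∀ v, f v = ∑ k, v k * l k := by
    intro v
    conv_lhs => rw [pi_eq_sum_univ' v]
    simp [map_sum, hl]
  have hneg : ∀ s : ℝ, 0 < s → -(s * ∑ k, l k) < u := by
    intro s hs
    have := hfU (fun _ => -s) (fun _ => by simpa using hs)
    rw [hf, ← Finset.mul_sum] at this
    linarith
  have hu : 0 ≤ u := by
    by_contra! hlt
    rcases le_or_gt (∑ k, l k) 0 with h0 | h0
    · have := hneg 1 one_pos
      linarith
    · have := hneg (-u / ∑ k, l k) (div_pos (neg_pos.2 hlt) h0)
      rw [div_mul_cancel₀ _ h0.ne'] at this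
      linarith
  have hl0 : ∀ k, 0 ≤ l k := by
    intro k
    by_contra! hlt
    -- Evaluate at the vectors `-s e_k - (1, …, 1)` of the negative orthant, for large `s`.
    have hs : ∀ s : ℝ, 0 ≤ s → -(s * l k) - ∑ j, l j < u := by
      intro s hs
      have := hfU (fun j => -(if j = k then s else 0) - 1) (fun j => by
        dsimp only; split_ifs <;> linarith)
      rw [hf] at this
      simpa [sub_mul, Finset.sum_sub_distrib] using this
    have h1 := hs ((|u| + |∑ j, l j|) / -l k) (by
      apply div_nonneg (by positivity); linarith)
    have h2 : -((|u| + |∑ j, l j|) / -l k * l k) = |u| + |∑ j, l j| := by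
      rw [div_neg, neg_mul, neg_neg, div_mul_cancel₀ _ hlt.ne]
    rw [h2] at h1
    linarith [le_abs_self u, le_abs_self (∑ j, l j)]
  have hx : ∀ x, (∑ k, l k) * a x ≤ ∑ k, l k * b x k := by
    intro x
    have := hu.trans (hfS _ (subset_convexHull ℝ S ⟨x, rfl⟩))
    rw [hf] at this
    simp only [sub_mul, Finset.sum_sub_distrib, ← Finset.mul_sum] at this
    simp only [mul_comm (l _)]
    linarith
  have hpos : 0 < ∑ k, l k := by
    refine lt_of_le_of_ne (Finset.sum_nonneg fun k _ => hl0 k) fun h0 => ?_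
    have hl' : ∀ k, l k = 0 := fun k =>
      (Finset.sum_eq_zero_iff_of_nonneg fun k _ => hl0 k).1 h0.symm k (Finset.mem_univ k)
    obtain ⟨x⟩ := ‹Nonempty X›
    have h1 := hneg 1 one_pos
    have h2 := hfS _ (subset_convexHull ℝ S ⟨x, rfl⟩)
    rw [hf] at h2
    simp [hl'] at h1 h2
    linarith
  refine ⟨fun k => l k / ∑ j, l j, fun k => div_nonneg (hl0 k) hpos.le, ?_, fun x => ?_⟩
  · rw [← Finset.sum_div, div_self hpos.ne']
  · have := hx x
    simp only [div_mul_eq_mul_div, ← Finset.sum_div]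
    rw [le_div_iff₀ hpos]
    linarith

theorem exists_net_closedBall (𝕜 : Type*) [RCLike 𝕜] (G : Type*) [NormedAddCommGroup G]
    [NormedSpace 𝕜 G] [FiniteDimensional 𝕜 G] {δ : ℝ} (hδ : 0 < δ) :
    ∃ (N : ℕ) (y : Fin N → G), (∀ k, ‖y k‖ ≤ 1) ∧ ∀ z : G, ‖z‖ ≤ 1 → ∃ k, ‖z - y k‖ ≤ δ := by
  have := FiniteDimensional.proper 𝕜 G
  obtain ⟨t, hts, htf, ht⟩ := (isCompact_closedBall (0 : G) 1).finite_cover_balls hδ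
  have := htf.to_subtype
  obtain ⟨N, ⟨e⟩⟩ := Finite.exists_equiv_fin t
  refine ⟨N, fun k => (e.symm k : G), fun k => by simpa using hts (e.symm k).2, fun z hz => ?_⟩
  obtain ⟨y, hy, hzy⟩ := Set.mem_iUnion₂.1 (ht (by simpa using hz : z ∈ Metric.closedBall 0 1))
  refine ⟨e ⟨y, hy⟩, ?_⟩
  simpa [dist_eq_norm] using (Metric.mem_ball.1 hzy).le

/-- An operator nearly attains its norm on any `δ`-net `y` of the unit ball. -/
theorem exists_norm_le_norm_apply_of_net {G H : Type*} [NormedAddCommGroup G] [NormedSpace 𝕜 G]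
    [NormedAddCommGroup H] [NormedSpace 𝕜 H] (Φ : G →L[𝕜] H) {δ : ℝ} {N : ℕ}
    {y : Fin N → G} (hy : ∀ z : G, ‖z‖ ≤ 1 → ∃ k, ‖z - y k‖ ≤ δ) :
    ∃ k, (1 - δ) * ‖Φ‖ ≤ ‖Φ (y k)‖ := by
  obtain ⟨k₀, hk₀⟩ := hy 0 (by simp)
  have : Nonempty (Fin N) := ⟨k₀⟩
  obtain ⟨k, hk⟩ := Finite.exists_max fun k => ‖Φ (y k)‖
  refine ⟨k, ?_⟩
  have hδ : 0 ≤ δ := (norm_nonneg _).trans hk₀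
  have : ‖Φ‖ ≤ ‖Φ (y k)‖ + ‖Φ‖ * δ := by
    let _ : NormedSpace ℝ G := NormedSpace.restrictScalars ℝ 𝕜 G
    refine Φ.opNorm_le_of_unit_norm (by positivity) fun z hz => ?_
    obtain ⟨j, hj⟩ := hy z hz.le
    calc ‖Φ z‖ = ‖Φ (y j) + Φ (z - y j)‖ := by simp
      _ ≤ ‖Φ (y j)‖ + ‖Φ (z - y j)‖ := norm_add_le _ _
      _ ≤ ‖Φ (y k)‖ + ‖Φ‖ * δ := by
        gcongr
        · exact hk j
        · exact (Φ.le_opNorm _).trans (by gcongr)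
  linarith

/-- Finite-dimensional spaces are reflexive, with control of the norm. -/
theorem exists_forall_apply_eq {G : Type*} [NormedAddCommGroup G] [NormedSpace 𝕜 G]
    [FiniteDimensional 𝕜 G] (φ : StrongDual 𝕜 (StrongDual 𝕜 G)) :
    ∃ y : G, ‖y‖ ≤ ‖φ‖ ∧ ∀ g, φ g = g y := by
  set y := (Module.evalEquiv 𝕜 G).symm (φ.toLinearMap ∘ₗ
    (LinearMap.toContinuousLinearMap : (G →ₗ[𝕜] 𝕜) ≃ₗ[𝕜] (G →L[𝕜] 𝕜)).toLinearMap) with hy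
  have key : ∀ g, φ g = g y := by
    intro g
    have := Module.apply_evalEquiv_symm_apply (R := 𝕜) (M := G) g.toLinearMap
      (φ.toLinearMap ∘ₗ
        (LinearMap.toContinuousLinearMap : (G →ₗ[𝕜] 𝕜) ≃ₗ[𝕜] (G →L[𝕜] 𝕜)).toLinearMap)
    rw [← hy] at this
    exact this.symm
  refine ⟨y, NormedSpace.norm_le_dual_bound 𝕜 y (norm_nonneg φ) fun g => ?_, key⟩
  rw [← key]
  exact φ.le_opNorm g

/-- Pietsch domination on the dual of a finite-dimensional space `G`, up to a factor `r > 1`, by a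
measure with finite support in `G`. The hypothesis `hu` says that `u` is `p`-summing with constant
`C`, with the weak norm computed on the unit ball of `G` in place of that of the bidual. -/
theorem exists_finite_domination {G H : Type*} [NormedAddCommGroup G] [NormedSpace 𝕜 G]
    [FiniteDimensional 𝕜 G] [NormedAddCommGroup H] [NormedSpace 𝕜 H]
    {p : ℝ} (hp : 1 ≤ p) (u : StrongDual 𝕜 G →L[𝕜] H) {C : ℝ} (hC : 0 ≤ C)
    (hu : ∀ (n : ℕ) (g : Fin n → StrongDual 𝕜 G) (R : ℝ), 0 ≤ R →
      (∀ y : G, ‖y‖ ≤ 1 → (∑ i, ‖g i y‖ ^ p) ^ (1 / p) ≤ R) →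
      (∑ i, ‖u (g i)‖ ^ p) ^ (1 / p) ≤ C * R) {r : ℝ} (hr : 1 < r) :
    ∃ (N : ℕ) (z : Fin N → G), (∑ k, ‖z k‖ ^ p) ^ (1 / p) ≤ r * C ∧
      ∀ g, ‖u g‖ ^ p ≤ ∑ k, ‖g (z k)‖ ^ p := by
  have hp0 : 0 < p := one_pos.trans_le hp
  have hr0 : 0 < r := one_pos.trans hr
  have : Fact (1 ≤ ENNReal.ofReal p) := ⟨by simpa using ENNReal.ofReal_le_ofReal hp⟩
  have hpR : (ENNReal.ofReal p).toReal = p := ENNReal.toReal_ofReal hp0.le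
  -- With `δ = 1 - r⁻¹`, passing from the unit ball to a `δ`-net costs exactly the factor `r`.
  have hδ : 0 < 1 - r⁻¹ := sub_pos.2 (inv_lt_one_of_one_lt₀ hr)
  obtain ⟨N, y, hy1, hy⟩ := exists_net_closedBall 𝕜 G hδ
  have hroot : ∀ t : ℝ, 0 ≤ t → (t ^ (1 / p)) ^ p = t := fun t ht => by
    rw [← Real.rpow_mul ht, one_div_mul_cancel hp0.ne', Real.rpow_one]
  obtain ⟨c, hc0, hc1, hc⟩ := exists_weights (fun g : StrongDual 𝕜 G => ‖u g‖ ^ p)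
    (fun g k => (r * C) ^ p * ‖g (y k)‖ ^ p) (fun t ht g => by
      refine ⟨((t ^ (1 / p) : ℝ) : 𝕜) • g, ?_, fun k => ?_⟩
      · rw [map_smul, norm_smul, RCLike.norm_ofReal, abs_of_nonneg (by positivity),
          Real.mul_rpow (by positivity) (by positivity), hroot t ht]
      · rw [smul_apply, norm_smul, RCLike.norm_ofReal,
          abs_of_nonneg (by positivity), Real.mul_rpow (Real.rpow_nonneg ht _) (norm_nonneg _),
          hroot t ht]
        ring) (fun n g => by
      let Φ : G →L[𝕜] PiLp (ENNReal.ofReal p) (fun _ : Fin n => 𝕜) :=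
        (PiLp.continuousLinearEquiv (ENNReal.ofReal p) 𝕜 fun _ : Fin n => 𝕜).symm.toContinuousLinearMap
          ∘L ContinuousLinearMap.pi g
      have hΦ : ∀ z, ‖Φ z‖ = (∑ i, ‖g i z‖ ^ p) ^ (1 / p) := fun z => by
        rw [PiLp.norm_eq_sum (by rwa [hpR]), hpR]
        rfl
      obtain ⟨k, hk⟩ := exists_norm_le_norm_apply_of_net Φ hy
      refine ⟨k, ?_⟩
      have h1 := hu n g ‖Φ‖ (norm_nonneg _) fun z hz => by
        rw [← hΦ]
        exact (Φ.le_opNorm z).trans (mul_le_of_le_one_right (norm_nonneg _) hz)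
      rw [sub_sub_cancel, inv_mul_le_iff₀ hr0] at hk
      have h2 : (∑ i, ‖u (g i)‖ ^ p) ^ (1 / p) ≤ r * C * ‖Φ (y k)‖ := by
        refine h1.trans ((mul_le_mul_of_nonneg_left hk hC).trans_eq (by ring))
      have h3 := Real.rpow_le_rpow (by positivity) h2 hp0.le
      rw [hroot _ (by positivity), Real.mul_rpow (by positivity) (by positivity), hΦ,
        hroot _ (by positivity), Finset.mul_sum] at h3
      exact h3)
  have hfac : ∀ k, 0 ≤ r * C * c k ^ (1 / p) := fun k =>
    mul_nonneg (by positivity) (Real.rpow_nonneg (hc0 k) _)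
  have hpow : ∀ k, ∀ t : ℝ, 0 ≤ t → (r * C * c k ^ (1 / p) * t) ^ p =
      c k * ((r * C) ^ p * t ^ p) := fun k t ht => by
    rw [Real.mul_rpow (hfac k) ht, Real.mul_rpow (by positivity) (Real.rpow_nonneg (hc0 k) _),
      hroot _ (hc0 k)]
    ring
  refine ⟨N, fun k => ((r * C * c k ^ (1 / p) : ℝ) : 𝕜) • y k, ?_, fun g => ?_⟩
  · have : ∑ k, ‖((r * C * c k ^ (1 / p) : ℝ) : 𝕜) • y k‖ ^ p ≤ (r * C) ^ p := by
      calc _ = ∑ k, c k * ((r * C) ^ p * ‖y k‖ ^ p) := by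
            refine Finset.sum_congr rfl fun k _ => ?_
            rw [norm_smul, RCLike.norm_ofReal, abs_of_nonneg (hfac k), hpow k _ (norm_nonneg _)]
        _ ≤ ∑ k, c k * (r * C) ^ p := by
            refine Finset.sum_le_sum fun k _ => mul_le_mul_of_nonneg_left ?_ (hc0 k)
            exact mul_le_of_le_one_right (by positivity)
              (Real.rpow_le_one (norm_nonneg _) (hy1 k) hp0.le)
        _ = (r * C) ^ p := by rw [← Finset.sum_mul, hc1, one_mul]
    refine (Real.rpow_le_rpow (by positivity) this (by positivity)).trans_eq ?_
    rw [← Real.rpow_mul (by positivity), mul_one_div_cancel hp0.ne', Real.rpow_one]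
  · refine (hc g).trans_eq (Finset.sum_congr rfl fun k _ => ?_)
    rw [map_smul, norm_smul, RCLike.norm_ofReal, abs_of_nonneg (hfac k), hpow k _ (norm_nonneg _)]

/-! ### Membership in the `p`-convex hull from domination -/

/-- The coefficients come from a Hahn–Banach extension to `ℓ_p^N` of the functional
`(g z_k)_k ↦ g v`. The inequality for `a` in the conclusion expresses that `a` lies in the unit ball of the dual of
`ℓ_p^N`, uniformly in `p ≥ 1`. -/
theorem exists_coeff_of_forall_dual {G : Type*} [NormedAddCommGroup G] [NormedSpace 𝕜 G]
    {p : ℝ} (hp : 1 ≤ p) {N : ℕ} (z : Fin N → G) (v : G)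
    (h : ∀ g : StrongDual 𝕜 G, ‖g v‖ ^ p ≤ ∑ k, ‖g (z k)‖ ^ p) :
    ∃ a : Fin N → 𝕜, v = ∑ k, a k • z k ∧
      ∀ b : Fin N → 𝕜, ‖∑ k, a k * b k‖ ≤ (∑ k, ‖b k‖ ^ p) ^ (1 / p) := by
  have hp0 : 0 < p := one_pos.trans_le hp
  have : Fact (1 ≤ ENNReal.ofReal p) := ⟨by simpa using ENNReal.ofReal_le_ofReal hp⟩
  have hpR : (ENNReal.ofReal p).toReal = p := ENNReal.toReal_ofReal hp0.le
  let V := PiLp (ENNReal.ofReal p) fun _ : Fin N => 𝕜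
  have hnorm : ∀ b : V, ‖b‖ = (∑ k, ‖b k‖ ^ p) ^ (1 / p) := fun b => by
    rw [PiLp.norm_eq_sum (by rwa [hpR]), hpR]
  let Ψ : StrongDual 𝕜 G →ₗ[𝕜] V :=
    (WithLp.linearEquiv (ENNReal.ofReal p) 𝕜 (Fin N → 𝕜)).symm.toLinearMap ∘ₗ
      { toFun := fun g k => g (z k), map_add' := fun _ _ => rfl, map_smul' := fun _ _ => rfl }
  have hΨ : ∀ g k, Ψ g k = g (z k) := fun _ _ => rfl
  let ev : StrongDual 𝕜 G →ₗ[𝕜] 𝕜 :=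
    { toFun := fun g => g v, map_add' := fun _ _ => rfl, map_smul' := fun _ _ => rfl }
  have hev : ∀ g, ‖ev g‖ ≤ ‖Ψ g‖ := by
    intro g
    rw [hnorm]
    calc ‖ev g‖ = (‖g v‖ ^ p) ^ (1 / p) := by
          rw [← Real.rpow_mul (norm_nonneg _), mul_one_div_cancel hp0.ne', Real.rpow_one]
          rfl
      _ ≤ (∑ k, ‖Ψ g k‖ ^ p) ^ (1 / p) := by
          gcongr
          exact h g
  -- By `hev`, `ev` vanishes on the kernel of `Ψ`, so it factors through `Ψ`.
  have hker : ev ∈ LinearMap.range Ψ.dualMap := by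
    rw [LinearMap.range_dualMap_eq_dualAnnihilator_ker, Submodule.mem_dualAnnihilator]
    intro g hg
    have := hev g
    rw [LinearMap.mem_ker.1 hg, norm_zero] at this
    exact norm_le_zero_iff.1 this
  obtain ⟨l, hl⟩ := hker
  have hl' : ∀ g, l (Ψ g) = g v := fun g => LinearMap.congr_fun hl g
  obtain ⟨m, hm, hmn⟩ := exists_extension_norm_eq (LinearMap.range Ψ)
    ((l.domRestrict (LinearMap.range Ψ)).mkContinuous 1 (by
      rintro ⟨_, g, rfl⟩
      rw [LinearMap.domRestrict_apply, hl', one_mul]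
      exact hev g))
  have hm1 : ‖m‖ ≤ 1 := hmn.le.trans (LinearMap.mkContinuous_norm_le _ zero_le_one _)
  have hmb : ∀ b : V, m b = ∑ k, m (PiLp.single (ENNReal.ofReal p) k 1) * b k := by
    intro b
    have hb : b = ∑ k, b k • PiLp.single (ENNReal.ofReal p) k (1 : 𝕜) := by
      ext j
      simp [Pi.single_apply]
    conv_lhs => rw [hb]
    simp only [map_sum, map_smul, smul_eq_mul, mul_comm]
  refine ⟨fun k => m (PiLp.single (ENNReal.ofReal p) k 1), ?_, fun b => ?_⟩
  · refine (SeparatingDual.eq_iff_forall_dual_eq (R := 𝕜)).2 fun g => ?_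
    have h1 := hm ⟨Ψ g, g, rfl⟩
    simp only [LinearMap.mkContinuous_apply, LinearMap.domRestrict_apply, hl'] at h1
    rw [← h1, hmb, map_sum]
    simp [hΨ]
  · have h1 := m.le_of_opNorm_le hm1 (WithLp.toLp _ b)
    rw [hmb, one_mul, hnorm] at h1
    exact h1

theorem norm_le_one_of_forall_norm_sum_le {N : ℕ} {a : Fin N → 𝕜}
    (h : ∀ b : Fin N → 𝕜, ‖∑ k, a k * b k‖ ≤ (∑ k, ‖b k‖ ^ (1 : ℝ)) ^ (1 / (1 : ℝ))) (k : Fin N) :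
    ‖a k‖ ≤ 1 := by
  have := h (Pi.single k 1)
  simpa [Pi.single_apply, apply_ite norm] using this

/-- The dual of `ℓ_p^N` is `ℓ_{p'}^N` for `p > 1`: test on a vector for which Hölder is sharp. -/
theorem sum_rpow_conjExponent_le_one {p : ℝ} (hp : 1 < p) {N : ℕ} {a : Fin N → 𝕜}
    (h : ∀ b : Fin N → 𝕜, ‖∑ k, a k * b k‖ ≤ (∑ k, ‖b k‖ ^ p) ^ (1 / p)) :
    ∑ k, ‖a k‖₊ ^ p.conjExponent ≤ 1 := by
  have hpq := Real.HolderConjugate.conjExponent hp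
  obtain ⟨g, hg, hga⟩ :=
    (NNReal.isGreatest_Lp Finset.univ (fun k => ‖a k‖₊) hpq.symm).1
  have h1 := h fun k => (starRingEnd 𝕜 (a k) / (‖a k‖ : 𝕜)) * ((g k : ℝ) : 𝕜)
  have h2 : ∀ k, a k * ((starRingEnd 𝕜 (a k) / (‖a k‖ : 𝕜)) * ((g k : ℝ) : 𝕜)) =
      ((‖a k‖ * g k : ℝ) : 𝕜) := by
    intro k
    rcases eq_or_ne (a k) 0 with h0 | h0
    · simp [h0]
    · have : (‖a k‖ : 𝕜) ≠ 0 := by simpa using h0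
      field_simp
      rw [RCLike.mul_conj]
      push_cast
      ring
  have h3 : ∀ k, ‖(starRingEnd 𝕜 (a k) / (‖a k‖ : 𝕜)) * ((g k : ℝ) : 𝕜)‖ ≤ g k := by
    intro k
    rw [norm_mul, norm_div, RCLike.norm_conj]
    simp only [RCLike.norm_ofReal, abs_norm, NNReal.abs_eq]
    exact mul_le_of_le_one_left (g k).2 (div_self_le_one _)
  have h4 : ((∑ k, ‖a k‖₊ * g k : ℝ≥0) : ℝ) ≤ 1 := by
    simp only [h2] at h1
    rw [← RCLike.ofReal_sum, RCLike.norm_ofReal] at h1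
    have h5 : (∑ k, ‖(starRingEnd 𝕜 (a k) / (‖a k‖ : 𝕜)) * ((g k : ℝ) : 𝕜)‖ ^ p) ^ (1 / p) ≤ 1 := by
      refine Real.rpow_le_one (by positivity) ?_ (by positivity)
      calc _ ≤ ∑ k, (g k : ℝ) ^ p := by
            gcongr with k
            exact h3 k
        _ ≤ 1 := by exact_mod_cast hg
    push_cast
    exact (le_abs_self _).trans (h1.trans h5)
  have h6 : (∑ k, ‖a k‖₊ ^ p.conjExponent) ^ (1 / p.conjExponent) ≤ 1 := by
    rw [← hga]
    exact_mod_cast h4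
  simpa using (NNReal.rpow_le_rpow_iff (by have := hpq.symm.pos; positivity)).1 (h6.trans (NNReal.one_rpow _).ge)

theorem strongNorm_extend {H : Type*} [NormedAddCommGroup H] {p : ℝ} (hp : 0 < p) {N : ℕ}
    (z : Fin N → H) :
    strongNorm p (Function.extend Fin.val z 0) = (∑ k, ‖z k‖ₑ ^ p) ^ (1 / p) := by
  rw [strongNorm]
  congr 1
  rw [← Function.Injective.tsum_eq (g := (Fin.val : Fin N → ℕ)) Fin.val_injective, tsum_fintype]
  · simp [Fin.val_injective.extend_apply]
  · intro n hn
    by_contra h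
    rw [Function.mem_support, Function.extend_apply' _ _ _ h] at hn
    simp [hp] at hn

theorem extend_mem_coeffBall {p : ℝ} (hp : 1 ≤ p) {N : ℕ} {a : Fin N → 𝕜}
    (ha : ∀ b : Fin N → 𝕜, ‖∑ k, a k * b k‖ ≤ (∑ k, ‖b k‖ ^ p) ^ (1 / p)) :
    Function.extend Fin.val a 0 ∈ coeffBall 𝕜 p := by
  rcases hp.eq_or_lt with rfl | hp1
  · rw [coeffBall, Set.mem_ofPred_eq, if_pos rfl]
    have hout : ∀ n, N ≤ n → Function.extend Fin.val a 0 n = 0 := fun n hn =>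
      Function.extend_apply' _ _ _ (by rintro ⟨k, rfl⟩; exact absurd k.2 hn.not_gt)
    refine ⟨tendsto_const_nhds.congr' ?_, fun n => ?_⟩
    · filter_upwards [Filter.eventually_ge_atTop N] with n hn using (hout n hn).symm
    · rcases lt_or_ge n N with hn | hn
      · have := norm_le_one_of_forall_norm_sum_le ha ⟨n, hn⟩
        rwa [← Fin.val_injective.extend_apply a 0] at this
      · simp [hout n hn]
  · rw [coeffBall, Set.mem_ofPred_eq, if_neg hp1.ne',
      strongNorm_extend (Real.HolderConjugate.conjExponent hp1).symm.pos]
    have h := sum_rpow_conjExponent_le_one hp1 ha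
    have hq := (Real.HolderConjugate.conjExponent hp1).symm.pos
    refine ENNReal.rpow_le_one ?_ (by positivity)
    simp_rw [enorm_eq_nnnorm, ← ENNReal.coe_rpow_of_nonneg _ hq.le]
    exact_mod_cast h

theorem pSize_le_of_forall_dual {G : Type*} [NormedAddCommGroup G] [NormedSpace 𝕜 G]
    {p : ℝ} (hp : 1 ≤ p) {N : ℕ} (z : Fin N → G) {K : Set G}
    (h : ∀ v ∈ K, ∀ g : StrongDual 𝕜 G, ‖g v‖ ^ p ≤ ∑ k, ‖g (z k)‖ ^ p) :
    pSize 𝕜 p K ≤ (∑ k, ‖z k‖ₑ ^ p) ^ (1 / p) := by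
  have hp0 : 0 < p := one_pos.trans_le hp
  rw [← strongNorm_extend hp0]
  refine iInf₂_le_of_le _ ?_ (iInf_le _ ?_)
  · rw [strongNorm_extend hp0, ← ofReal_sum_norm_rpow hp0]
    exact ENNReal.ofReal_lt_top
  · intro v hv
    obtain ⟨a, rfl, ha⟩ := exists_coeff_of_forall_dual hp z v (h v hv)
    refine ⟨_, extend_mem_coeffBall hp ha, ?_⟩
    rw [← Function.Injective.hasSum_iff (g := (Fin.val : Fin N → ℕ)) Fin.val_injective]
    · convert hasSum_fintype fun k => a k • z k using 2 with k
      simp [Fin.val_injective.extend_apply]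
    · intro n hn
      rw [Function.extend_apply' _ _ _ hn]
      simp

/-! ### The hull norm is at most the summing norm of the adjoint -/

/-- If `C` is a `p`-summing constant of the adjoint of `T`, then `κ_p(Q_L T I_M) ≤ C`. -/
theorem kappa_mkQL_comp_le {p : ℝ} (hp : 1 ≤ p) {E F : Type*} [NormedAddCommGroup E]
    [NormedSpace 𝕜 E] [NormedAddCommGroup F] [NormedSpace 𝕜 F] (T : E →L[𝕜] F) {C : ℝ≥0}
    (hC : ∀ (n : ℕ) (f : Fin n → StrongDual 𝕜 F),
      (∑ i, ‖(f i) ∘L T‖ₑ ^ p) ^ (1 / p) ≤ C * weakNorm 𝕜 p f)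
    (M : Submodule 𝕜 E) (L : Submodule 𝕜 F) [IsClosed (L : Set F)]
    [FiniteDimensional 𝕜 (F ⧸ L)] :
    kappa 𝕜 p M (F ⧸ L) (L.mkQL ∘L T ∘L M.subtypeL) ≤ C := by
  have hp0 : 0 < p := one_pos.trans_le hp
  refine le_of_forall_one_lt_mul_le fun r hr => ?_
  let Q : F →L[𝕜] F ⧸ L := L.mkQL
  have hQ : ∀ x, ‖Q x‖ ≤ 1 * ‖x‖ := fun x => by
    rw [one_mul]
    exact Submodule.Quotient.norm_mk_le L x
  have hQ1 : ‖Q‖ ≤ 1 := Q.opNorm_le_bound zero_le_one hQ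
  let Qd : StrongDual 𝕜 (F ⧸ L) →L[𝕜] StrongDual 𝕜 F := ContinuousLinearMap.precomp 𝕜 Q
  have hQd : ‖Qd‖ ≤ 1 := Qd.opNorm_le_bound zero_le_one fun g => by
    rw [mul_comm]
    exact (ContinuousLinearMap.opNorm_comp_le g Q).trans
      (mul_le_mul_of_nonneg_left hQ1 (norm_nonneg _))
  let u : StrongDual 𝕜 (F ⧸ L) →L[𝕜] StrongDual 𝕜 E := ContinuousLinearMap.precomp 𝕜 T ∘L Qd
  obtain ⟨N, z, hz, hdom⟩ := exists_finite_domination hp u C.coe_nonneg (fun n g R hR hg => by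
    rw [← ENNReal.ofReal_le_ofReal_iff (mul_nonneg C.coe_nonneg hR), ofReal_sum_norm_rpow hp0,
      ENNReal.ofReal_mul C.coe_nonneg]
    refine (hC n fun i => Qd (g i)).trans ?_
    rw [ENNReal.ofReal_coe_nnreal]
    gcongr
    refine iSup₂_le fun φ hφ => ?_
    -- A functional `φ` on `F'`, restricted to `(F ⧸ L)'`, is evaluation at a point of `F ⧸ L`.
    obtain ⟨y, hy, hyg⟩ := exists_forall_apply_eq (φ ∘L Qd)
    have hy1 : ‖y‖ ≤ 1 := hy.trans ((φ.opNorm_comp_le Qd).trans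
      (mul_le_one₀ hφ (norm_nonneg _) hQd))
    rw [← ofReal_sum_norm_rpow hp0]
    refine ENNReal.ofReal_le_ofReal ?_
    have : ∀ i, φ (Qd (g i)) = g i y := fun i => hyg (g i)
    simpa only [this] using hg y hy1) (r := r) (by exact_mod_cast hr)
  refine (pSize_le_of_forall_dual hp z ?_).trans ?_
  · rintro _ ⟨e, he, rfl⟩ g
    refine le_trans ?_ (hdom g)
    gcongr
    refine ((u g).le_opNorm (e : E)).trans (mul_le_of_le_one_right (norm_nonneg _) ?_)
    simpa using he
  · rw [← ofReal_sum_norm_rpow hp0]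
    refine (ENNReal.ofReal_le_ofReal hz).trans_eq ?_
    rw [ENNReal.ofReal_mul r.coe_nonneg]
    simp

/-! ### The summing norm of the adjoint is at most the hull norm -/

theorem enorm_apply_le_strongNorm {G : Type*} [NormedAddCommGroup G] [NormedSpace 𝕜 G]
    {p : ℝ} (hp : 1 ≤ p) {x : ℕ → G} {v : G} (hv : v ∈ pConvexHull 𝕜 p x)
    (g : StrongDual 𝕜 G) : ‖g v‖ₑ ≤ strongNorm p fun n => g (x n) := by
  obtain ⟨a, ha, hav⟩ := hv
  have h1 := (g.hasSum hav).enorm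
  refine le_of_tendsto h1 (Filter.Eventually.of_forall fun s => ?_)
  have h2 : ‖∑ n ∈ s, g (a n • x n)‖ₑ ≤ ∑ n ∈ s, ‖a n‖ₑ * ‖g (x n)‖ₑ :=
    (enorm_sum_le _ _).trans_eq (Finset.sum_congr rfl fun n _ => by
      rw [map_smul, smul_eq_mul, enorm_mul])
  refine h2.trans ?_
  rcases hp.eq_or_lt with rfl | hp1
  · rw [coeffBall, Set.mem_ofPred_eq, if_pos rfl] at ha
    simp only [strongNorm, ENNReal.rpow_one, div_one]
    refine le_trans (Finset.sum_le_sum fun n _ => ?_) (ENNReal.sum_le_tsum s)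
    refine mul_le_of_le_one_left' ?_
    simpa [← ofReal_norm] using ha.2 n
  · rw [coeffBall, Set.mem_ofPred_eq, if_neg hp1.ne'] at ha
    have hpq := Real.HolderConjugate.conjExponent hp1
    have hp0 := hpq.pos
    have hq0 := hpq.symm.pos
    refine (ENNReal.inner_le_Lp_mul_Lq s _ _ hpq.symm).trans ?_
    calc _ ≤ strongNorm p.conjExponent a * strongNorm p (fun n => g (x n)) := by
          unfold strongNorm
          gcongr <;> exact ENNReal.sum_le_tsum s
      _ ≤ _ := mul_le_of_le_one_left' ha

/-- Operators with values in the hull of `x` have a `p`-summing adjoint; `W` bounds the weak norm of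
the family `g`, tested on points of `G` only. -/
theorem sum_enorm_apply_le_mul_strongNorm {G : Type*} [NormedAddCommGroup G] [NormedSpace 𝕜 G]
    {p : ℝ} (hp : 1 ≤ p) {x : ℕ → G} {n : ℕ} {g : Fin n → StrongDual 𝕜 G} {v : Fin n → G}
    (hv : ∀ i, v i ∈ pConvexHull 𝕜 p x) {W : ℝ≥0∞}
    (hW : ∀ y : G, (∑ i, ‖g i y‖ₑ ^ p) ^ (1 / p) ≤ W * ‖y‖ₑ) :
    (∑ i, ‖g i (v i)‖ₑ ^ p) ^ (1 / p) ≤ W * strongNorm p x := by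
  have hp0 : 0 < p := one_pos.trans_le hp
  have hW' : ∀ y : G, ∑ i, ‖g i y‖ₑ ^ p ≤ W ^ p * ‖y‖ₑ ^ p := fun y => by
    have := ENNReal.rpow_le_rpow (hW y) hp0.le
    rwa [← ENNReal.rpow_mul, one_div_mul_cancel hp0.ne', ENNReal.rpow_one,
      ENNReal.mul_rpow_of_nonneg _ _ hp0.le] at this
  have h1 : ∀ i, ‖g i (v i)‖ₑ ^ p ≤ ∑' m, ‖g i (x m)‖ₑ ^ p := fun i => by
    have := ENNReal.rpow_le_rpow (enorm_apply_le_strongNorm hp (hv i) (g i)) hp0.le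
    rwa [strongNorm, ← ENNReal.rpow_mul, one_div_mul_cancel hp0.ne', ENNReal.rpow_one] at this
  have h2 : ∑ i, ‖g i (v i)‖ₑ ^ p ≤ W ^ p * ∑' m, ‖x m‖ₑ ^ p := by
    calc _ ≤ ∑ i, ∑' m, ‖g i (x m)‖ₑ ^ p := Finset.sum_le_sum fun i _ => h1 i
      _ = ∑' m, ∑ i, ‖g i (x m)‖ₑ ^ p :=
        (Summable.tsum_finsetSum fun _ _ => ENNReal.summable).symm
      _ ≤ ∑' m, W ^ p * ‖x m‖ₑ ^ p := ENNReal.tsum_le_tsum fun m => hW' (x m)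
      _ = _ := ENNReal.tsum_mul_left
  refine (ENNReal.rpow_le_rpow h2 (by positivity)).trans_eq ?_
  rw [ENNReal.mul_rpow_of_nonneg _ _ (by positivity), ← ENNReal.rpow_mul,
    mul_one_div_cancel hp0.ne', ENNReal.rpow_one, strongNorm]

theorem sum_enorm_apply_le_weakNorm {F : Type*} [NormedAddCommGroup F] [NormedSpace 𝕜 F]
    {p : ℝ} (hp : 0 < p) {n : ℕ} (f : Fin n → StrongDual 𝕜 F) (y : F) :
    (∑ i, ‖f i y‖ₑ ^ p) ^ (1 / p) ≤ weakNorm 𝕜 p f * ‖y‖ₑ := by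
  rcases eq_or_ne y 0 with rfl | hy
  · simp [hp]
  have hy' : (‖y‖ : 𝕜) ≠ 0 := by simpa using hy
  set y₁ : F := (‖y‖ : 𝕜)⁻¹ • y with hy₁
  have hn : ‖y₁‖ = 1 := by
    rw [hy₁, norm_smul, norm_inv, RCLike.norm_ofReal, abs_norm,
      inv_mul_cancel₀ (norm_ne_zero_iff.2 hy)]
  have hle : (∑ i, ‖f i y₁‖ₑ ^ p) ^ (1 / p) ≤ weakNorm 𝕜 p f :=
    le_iSup₂_of_le (NormedSpace.inclusionInDoubleDual 𝕜 F y₁)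
      ((NormedSpace.double_dual_bound 𝕜 F y₁).trans_eq hn) le_rfl
  have hfy : ∀ i, ‖f i y‖ₑ = ‖y‖ₑ * ‖f i y₁‖ₑ := fun i => by
    have : y = (‖y‖ : 𝕜) • y₁ := by rw [hy₁, smul_inv_smul₀ hy']
    conv_lhs => rw [this, map_smul, smul_eq_mul, enorm_mul]
    congr 1
    rw [← ofReal_norm, RCLike.norm_ofReal, abs_norm, ofReal_norm]
  simp_rw [hfy]
  rw [sum_mul_rpow hp, mul_comm]
  gcongr

theorem sum_enorm_comp_le_of_maximalHull_kappa_lt {p : ℝ} (hp : 1 ≤ p) {E F : Type*}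
    [NormedAddCommGroup E] [NormedSpace 𝕜 E] [NormedAddCommGroup F] [NormedSpace 𝕜 F]
    (T : E →L[𝕜] F) {C : ℝ≥0∞} (hC : maximalHull (kappa 𝕜 p) E F T < C)
    {n : ℕ} (f : Fin n → StrongDual 𝕜 F) :
    (∑ i, ‖(f i) ∘L T‖ₑ ^ p) ^ (1 / p) ≤ C * weakNorm 𝕜 p f := by
  have hp0 : 0 < p := one_pos.trans_le hp
  refine le_of_forall_one_lt_mul_le fun r hr => ?_
  have hr0 : (0 : ℝ) < r := by exact_mod_cast one_pos.trans hr
  -- The factor `r` pays for the vectors `e i` being only nearly norming.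
  have he : ∀ i, ∃ e : E, ‖e‖ ≤ 1 ∧ ‖(f i) ∘L T‖ₑ ≤ r * ‖f i (T e)‖ₑ := by
    intro i
    rcases eq_or_ne ((f i) ∘L T) 0 with h0 | h0
    · exact ⟨0, by simp, by rw [h0, ← ofReal_norm, norm_zero]; simp⟩
    · have : (r : ℝ)⁻¹ * ‖(f i) ∘L T‖ < ‖(f i) ∘L T‖ :=
        mul_lt_of_lt_one_left (norm_pos_iff.2 h0) (inv_lt_one_of_one_lt₀ (by exact_mod_cast hr))
      obtain ⟨e, he1, he⟩ := ((f i) ∘L T).exists_lt_apply_of_lt_opNorm this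
      refine ⟨e, he1.le, ?_⟩
      rw [inv_mul_lt_iff₀ hr0] at he
      have := ENNReal.ofReal_le_ofReal he.le
      rwa [ENNReal.ofReal_mul hr0.le, ofReal_norm, ofReal_norm, ENNReal.ofReal_coe_nnreal] at this
  choose e he1 he using he
  let M : Submodule 𝕜 E := Submodule.span 𝕜 (Set.range e)
  have hM : FiniteDimensional 𝕜 M := FiniteDimensional.span_of_finite 𝕜 (Set.finite_range e)
  let P : F →L[𝕜] (Fin n → 𝕜) := ContinuousLinearMap.pi f
  let L : Submodule 𝕜 F := LinearMap.ker P.toLinearMap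
  have hL : IsClosed (L : Set F) := P.isClosed_ker
  have hFL : FiniteDimensional 𝕜 (F ⧸ L) :=
    Module.Finite.equiv P.toLinearMap.quotKerEquivRange.symm
  have hlt : kappa 𝕜 p M (F ⧸ L) (L.mkQL ∘L T ∘L M.subtypeL) < C := by
    refine lt_of_le_of_lt ?_ hC
    exact le_iSup_of_le M (le_iSup_of_le hM (le_iSup_of_le L (le_iSup_of_le hL
      (le_iSup_of_le hFL le_rfl))))
  -- A strict bound on the infimum that defines `κ_p` provides a sequence `x` within that bound.
  simp only [kappa, pSize, iInf_lt_iff] at hlt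
  obtain ⟨x, -, hx, hxC⟩ := hlt
  have hker : ∀ i, L ≤ LinearMap.ker (f i).toLinearMap := fun i y hy =>
    congrFun (LinearMap.mem_ker.1 hy) i
  let g : Fin n → StrongDual 𝕜 (F ⧸ L) := fun i =>
    LinearMap.toContinuousLinearMap (L.liftQ (f i).toLinearMap (hker i))
  have hg : ∀ i y, g i (L.mkQ y) = f i y := fun i y => L.liftQ_apply _ y
  -- The weak norm of the `g i` is controlled by lifting points of `F ⧸ L` to points of `F`.
  have hW : ∀ y : F ⧸ L, (∑ i, ‖g i y‖ₑ ^ p) ^ (1 / p) ≤ weakNorm 𝕜 p f * ‖y‖ₑ := by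
    intro y
    refine le_of_forall_one_lt_mul_le fun s hs => ?_
    rcases eq_or_ne y 0 with rfl | hy
    · simp [hp0]
    have hlt : ‖y‖ < s * ‖y‖ := lt_mul_of_one_lt_left (norm_pos_iff.2 hy) (by exact_mod_cast hs)
    obtain ⟨y', hyy, hy'⟩ : ∃ y' : F, L.mkQ y' = y ∧ ‖y'‖ < s * ‖y‖ :=
      QuotientAddGroup.norm_lt_iff.mp hlt
    have h1 : ‖y'‖ₑ ≤ s * ‖y‖ₑ := by
      have := ENNReal.ofReal_le_ofReal hy'.le
      rwa [ENNReal.ofReal_mul s.coe_nonneg, ofReal_norm, ofReal_norm,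
        ENNReal.ofReal_coe_nnreal] at this
    have h2 := sum_enorm_apply_le_weakNorm hp0 f y'
    simp_rw [← hg, hyy] at h2
    refine h2.trans ((mul_le_mul_right h1 _).trans_eq ?_)
    rw [mul_left_comm]
  have hmain := sum_enorm_apply_le_mul_strongNorm hp (g := g) (v := fun i => L.mkQ (T (e i)))
    (fun i => hx ⟨⟨e i, Submodule.subset_span ⟨i, rfl⟩⟩, by simpa using he1 i, rfl⟩) hW
  simp only [hg] at hmain
  calc (∑ i, ‖(f i) ∘L T‖ₑ ^ p) ^ (1 / p)
      ≤ (∑ i, (r * ‖f i (T (e i))‖ₑ) ^ p) ^ (1 / p) := by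
        gcongr with i
        exact he i
    _ = r * (∑ i, ‖f i (T (e i))‖ₑ ^ p) ^ (1 / p) := sum_mul_rpow hp0 _ _
    _ ≤ r * (C * weakNorm 𝕜 p f) := by
        refine mul_le_mul_right (hmain.trans ?_) _
        rw [mul_comm]
        gcongr

end PCompact

theorem corollary3p5 {𝕜 : Type*} [RCLike 𝕜] (p : ℝ) (hp : 1 ≤ p)
    (E : Type*) [NormedAddCommGroup E] [NormedSpace 𝕜 E] [CompleteSpace E]
    (F : Type*) [NormedAddCommGroup F] [NormedSpace 𝕜 F] [CompleteSpace F] :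
    PCompact.component (PCompact.maximalHull (PCompact.kappa 𝕜 p)) E F =
        PCompact.component (PCompact.dualIdeal (PCompact.summing 𝕜 p)) E F ∧
      ∀ T : E →L[𝕜] F,
        PCompact.maximalHull (PCompact.kappa 𝕜 p) E F T =
          PCompact.dualIdeal (PCompact.summing 𝕜 p) E F T := by
  have key : ∀ T : E →L[𝕜] F,
      PCompact.maximalHull (PCompact.kappa 𝕜 p) E F T =
        PCompact.dualIdeal (PCompact.summing 𝕜 p) E F T := by
    intro T
    apply le_antisymm
    · refine le_iInf₂ fun C hC => ?_
      refine iSup_le fun M => iSup_le fun _ => iSup_le fun L => iSup_le fun hL => iSup_le fun _ => ?_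
      exact PCompact.kappa_mkQL_comp_le hp T hC M L
    · refine le_of_forall_gt_imp_ge_of_dense fun C hC => ?_
      rcases eq_or_ne C ⊤ with rfl | hC'
      · exact le_top
      lift C to ℝ≥0 using hC'
      exact iInf₂_le C fun n f => PCompact.sum_enorm_comp_le_of_maximalHull_kappa_lt hp T hC f
  refine ⟨?_, key⟩
  ext T
  simp only [PCompact.component, Set.mem_ofPred_eq, key T]
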